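/- Let $d\in\{1,2\}$. Let $\mathsf M$ be a wide-sense stationary square integrable random signed measure on $\mathbb R^d$ over a probability space $(\Omega,\mathbf P)$, that is, a family of real random variables $I_{\mathsf M}(f)=\int f\,d\mathsf M\in L^2(\mathbf P)$, indexed by the measurable, bounded, compactly supported functions $f:\mathbb R^d\to\mathbb R$ (test functions), which is linear and $\sigma$-additive in $f$ almost surely, and such that $\mathbf E\, I_{\mathsf M}(f(\cdot-x))=\mathbf E\, I_{\mathsf M}(f)$ and $\mathrm{Var}\, I_{\mathsf M}(f(\cdot-x))=\mathrm{Var}\, I_{\mathsf M}(f)$ for all test functions $f$ and all $x\in\mathbb R^d$. Write $\mathsf M(A)=I_{\mathsf M}(1_A)$ for bounded measurable $A$. Suppose that $\mathsf M$ has a correlation measure $\mathcal C$: a signed Radon measure on $\mathbb R^d$ (with variation $|\mathcal C|$, possibly of infinite total mass) such that, the intensity being normalised to $1$, $$\mathrm{Cov}\big(I_{\mathsf M}(f),I_{\mathsf M}(g)\big)=\int_{\mathbb R^d}\int_{\mathbb R^d} f(y)\,g(x+y)\,dy\,\mathcal C(dx)\qquad\text{for all test functions } f,g .$$ Suppose moreover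 that $\mathsf M$ is - isotropic: $\mathrm{Var}\, I_{\mathsf M}(f\circ R)=\mathrm{Var}\, I_{\mathsf M}(f)$ for all test functions $f$ and all orthogonal transformations $R$ of $\mathbb R^d$; - hyperuniform: $\mathrm{Var}\big(\mathsf M(B(0,r))\big)/\mathrm{Vol}(B(0,r))\to 0$ as $r\to\infty$; - not (linearly) number rigid: there is a bounded measurable set $A\subset\mathbb R^d$ such that no sequence of test functions $h_n$ compactly supported in $A^c$ satisfies $I_{\mathsf M}(h_n)\to \mathsf M(A)$ almost surely and in $L^2(\mathbf P)$. Then $$\int_{\mathbb R^d}\|t\|^d\,|\mathcal C|(dt)=\infty .$$ -/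

import Mathlib

open MeasureTheory ProbabilityTheory Filter Topology
open scoped ENNReal

noncomputable section

/-- The space `ℝ^d` with its Euclidean norm. -/
abbrev RSpace (d : ℕ) : Type := EuclideanSpace ℝ (Fin d)

/-- Real test functions: measurable, bounded and compactly supported. -/
structure IsTestFun {d : ℕ} (f : RSpace d → ℝ) : Prop where
  measurable : Measurable f
  bounded : ∃ B : ℝ, ∀ x, |f x| ≤ B
  compactSupport : HasCompactSupport f

/-- A signed Radon measure on `ℝ^d`, of possibly infinite total mass, given by its Jordan
decomposition: two mutually singular locally finite Borel measures. -/
structure SignedRadonMeasure (d : ℕ) where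
  pos : Measure (RSpace d)
  neg : Measure (RSpace d)
  locallyFinite_pos : IsLocallyFiniteMeasure pos
  locallyFinite_neg : IsLocallyFiniteMeasure neg
  mutuallySingular : pos ⟂ₘ neg

namespace SignedRadonMeasure

variable {d : ℕ}

/-- The variation `|C|`. -/
def variation (C : SignedRadonMeasure d) : Measure (RSpace d) := C.pos + C.neg

/-- The integral `∫ F dC`, meaningful when `F` is `|C|`-integrable, for instance for bounded
measurable compactly supported `F`. -/
def integral (C : SignedRadonMeasure d) (F : RSpace d → ℝ) : ℝ :=
  (∫ x, F x ∂C.pos) - ∫ x, F x ∂C.neg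

end SignedRadonMeasure

/-- A square integrable random signed measure on `ℝ^d` over the probability space `(Ω, P)`,
given by its linear statistics `M.I f = ∫ f dM`, for test functions `f` (the values of `M.I` at
other functions play no role). The statistics are linear and `σ`-additive; the series in the
second axiom is only required to converge in probability, which is weaker than almost surely. -/
structure RandomSignedMeasure (d : ℕ) {Ω : Type*} [MeasurableSpace Ω] (P : Measure Ω) where
  I : (RSpace d → ℝ) → Ω → ℝ
  memLp : ∀ f, IsTestFun f → MemLp (I f) 2 P
  linear : ∀ (a b : ℝ) (f g : RSpace d → ℝ), IsTestFun f → IsTestFun g →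
    I (fun x => a * f x + b * g x) =ᵐ[P] fun ω => a * I f ω + b * I g ω
  sigmaAdditive : ∀ (f : ℕ → RSpace d → ℝ) (g : RSpace d → ℝ),
    (∀ n, IsTestFun (f n)) → IsTestFun g → (∀ n x, 0 ≤ f n x) →
    (∀ x, HasSum (fun n => f n x) (g x)) →
    TendstoInMeasure P (fun (N : ℕ) ω => ∑ n ∈ Finset.range N, I (f n) ω) atTop (I g)

namespace RandomSignedMeasure

variable {d : ℕ} {Ω : Type*} [MeasurableSpace Ω] {P : Measure Ω}

/-- Wide-sense stationarity: means and variances of linear statistics are invariant under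
translations of the test function. -/
def IsWideSenseStationary (M : RandomSignedMeasure d P) : Prop :=
  ∀ (f : RSpace d → ℝ) (x : RSpace d), IsTestFun f →
    (∫ ω, M.I (fun y => f (y - x)) ω ∂P) = (∫ ω, M.I f ω ∂P) ∧
    variance (M.I (fun y => f (y - x))) P = variance (M.I f) P

/-- Isotropy (to second order): variances of linear statistics are invariant under orthogonal
transformations of the test function. -/
def IsIsotropic (M : RandomSignedMeasure d P) : Prop :=
  ∀ (f : RSpace d → ℝ) (R : RSpace d ≃ₗᵢ[ℝ] RSpace d), IsTestFun f →
    variance (M.I (fun y => f (R y))) P = variance (M.I f) P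

/-- The mass `M(A)` of a bounded measurable set `A`. -/
def mass (M : RandomSignedMeasure d P) (A : Set (RSpace d)) : Ω → ℝ :=
  M.I (A.indicator fun _ => 1)

/-- Hyperuniformity: `Var M(B(0,r)) / Vol B(0,r) → 0` as `r → ∞`. -/
def IsHyperuniform (M : RandomSignedMeasure d P) : Prop :=
  Tendsto (fun r : ℝ => variance (M.mass (Metric.ball 0 r)) P /
    (volume (Metric.ball (0 : RSpace d) r)).toReal) atTop (𝓝 0)

/-- `C` is the correlation measure of `M` (with the normalisation of intensity one):
`Cov(I f, I g) = ∫∫ f(y) g(x + y) dy C(dx)` for all test functions `f`, `g`. -/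
def IsCorrelationMeasure (M : RandomSignedMeasure d P) (C : SignedRadonMeasure d) : Prop :=
  ∀ f g : RSpace d → ℝ, IsTestFun f → IsTestFun g →
    covariance (M.I f) (M.I g) P = C.integral fun x => ∫ y, f y * g (x + y)

/-- Linear `γ`-rigidity on `A`: the statistic `I γ` is a limit, almost surely and in `L²`, of
linear statistics `I hₙ` of test functions `hₙ` compactly supported in the complement of `A`. -/
def IsLinearlyRigid (M : RandomSignedMeasure d P) (γ : RSpace d → ℝ)
    (A : Set (RSpace d)) : Prop :=
  ∃ h : ℕ → RSpace d → ℝ,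
    (∀ n, IsTestFun (h n) ∧ tsupport (h n) ⊆ Aᶜ) ∧
    (∀ᵐ ω ∂P, Tendsto (fun n => M.I (h n) ω) atTop (𝓝 (M.I γ ω))) ∧
    Tendsto (fun n => eLpNorm (fun ω => M.I γ ω - M.I (h n) ω) 2 P) atTop (𝓝 0)

/-- (Linear) number rigidity: for every bounded measurable set `A`, the mass `M(A)` is linearly
determined by `M` outside `A`. -/
def IsNumberRigid (M : RandomSignedMeasure d P) : Prop :=
  ∀ A : Set (RSpace d), Bornology.IsBounded A → MeasurableSet A →
    M.IsLinearlyRigid (A.indicator fun _ => 1) A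

end RandomSignedMeasure

end

/-! Argue by contraposition: if `‖t‖ ^ d` is `|C|`-integrable, the mass of every bounded set is
predictable from outside. The moment makes `|C|` finite, and hyperuniformity then forces `C` to have
total mass zero. Constants therefore drop out of the covariance formula, leaving `Cov(I f, I g) =
-(1/2) ∫ incr f g dC`, which involves only increments of `f` and `g`.

For the cut-off `χ_R` at scale `R`, `incr χ_R χ_R x` is at most a constant times `R ^ d * min 1 (‖x‖
/ R) ^ 2`, hence, as `d ≤ 2`, at most a constant times `‖x‖ ^ d`. So `Var I(χ_R)` is bounded in `R`,
while `Cov(I f, I(χ_R)) → 0` for each fixed `f`. As in the Banach–Saks theorem, averages of `k`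
cut-offs of sparse radii have variance `O(1/k)`, yet still equal one on a given ball
(`exists_sum_cutoff`). Subtracting a distant translate removes the mean by stationarity, giving `φ =
1` on the ball with `I φ` small in `L²`.

Then `M(A) ≈ I(1_A - φ)`, and `1_A - φ` vanishes on `A`. Its closed support may still touch `A`;
this is cured by also erasing a set `S` of small volume outside `A` (`exists_predictor`). The cost
`I(1_S)` is small in `L²`: volume controls its variance, and countable additivity of the mean
controls its expectation. -/

/-! ### Test functions -/

namespace IsTestFun

variable {d : ℕ} {f g : RSpace d → ℝ}

theorem const_mul (hf : IsTestFun f) (a : ℝ) : IsTestFun fun x => a * f x := by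
  obtain ⟨B, hB⟩ := hf.bounded
  refine ⟨hf.measurable.const_mul a, ⟨|a| * B, fun x => ?_⟩, hf.compactSupport.mul_left⟩
  rw [abs_mul]
  exact mul_le_mul_of_nonneg_left (hB x) (abs_nonneg a)

theorem add (hf : IsTestFun f) (hg : IsTestFun g) : IsTestFun fun x => f x + g x := by
  obtain ⟨B, hB⟩ := hf.bounded
  obtain ⟨B', hB'⟩ := hg.bounded
  exact ⟨hf.measurable.add hg.measurable,
    ⟨B + B', fun x => (abs_add_le _ _).trans (add_le_add (hB x) (hB' x))⟩,
    hf.compactSupport.add hg.compactSupport⟩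

theorem lincomb (hf : IsTestFun f) (hg : IsTestFun g) (a b : ℝ) :
    IsTestFun fun x => a * f x + b * g x :=
  (hf.const_mul a).add (hg.const_mul b)

theorem translate (hf : IsTestFun f) (v : RSpace d) : IsTestFun fun y => f (y - v) := by
  obtain ⟨B, hB⟩ := hf.bounded
  refine ⟨hf.measurable.comp (measurable_sub_const v), ⟨B, fun x => hB _⟩, ?_⟩
  exact hf.compactSupport.comp_homeomorph (Homeomorph.subRight v)

theorem indicator {S : Set (RSpace d)} (hS : MeasurableSet S) (hb : Bornology.IsBounded S) :
    IsTestFun (S.indicator fun _ => (1 : ℝ)) := by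
  refine ⟨measurable_const.indicator hS, ⟨1, fun x => ?_⟩, ?_⟩
  · by_cases hx : x ∈ S <;> simp [hx]
  · refine HasCompactSupport.of_support_subset_isCompact hb.isCompact_closure ?_
    exact Set.support_indicator_subset.trans subset_closure

theorem integrable (hf : IsTestFun f) : Integrable f := by
  obtain ⟨B, hB⟩ := hf.bounded
  rw [← integrableOn_iff_integrable_of_support_subset (subset_tsupport f)]
  exact Measure.integrableOn_of_bounded hf.compactSupport.measure_lt_top.ne
    hf.measurable.aestronglyMeasurable (M := B) (ae_of_all _ fun x => hB x)

end IsTestFun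

/-! ### Correlations of functions -/

/-- The correlation `x ↦ ∫ f(y) g(x + y) dy` of two functions. -/
noncomputable def corr {d : ℕ} (f g : RSpace d → ℝ) (x : RSpace d) : ℝ := ∫ y, f y * g (x + y)

section corr

variable {d : ℕ} {f g : RSpace d → ℝ}

theorem IsTestFun.integrable_mul_add (hf : IsTestFun f) (hg : IsTestFun g) (x z : RSpace d) :
    Integrable fun y => f (x + y) * g (z + y) := by
  obtain ⟨B, hB⟩ := hf.bounded
  exact (hg.integrable.comp_add_left z).bdd_mul
    (hf.measurable.comp (measurable_const_add x)).aestronglyMeasurable (ae_of_all _ fun y => hB _)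

theorem IsTestFun.measurable_corr (hf : IsTestFun f) (hg : IsTestFun g) :
    Measurable (corr f g) := by
  have h : Measurable fun p : RSpace d × RSpace d => f p.2 * g (p.1 + p.2) :=
    (hf.measurable.comp measurable_snd).mul (hg.measurable.comp measurable_add)
  exact (StronglyMeasurable.integral_prod_right' (ν := volume) h.stronglyMeasurable).measurable

theorem abs_corr_le (hf : IsTestFun f) {B : ℝ} (hg : ∀ x, |g x| ≤ B) (x : RSpace d) :
    |corr f g x| ≤ B * ∫ y, |f y| := by
  have hB : 0 ≤ B := (abs_nonneg _).trans (hg 0)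
  have e := integral_const_mul (μ := volume) B fun y => |f y|
  rw [corr, ← e]
  refine (norm_integral_le_integral_norm (μ := volume) fun y => f y * g (x + y)).trans ?_
  refine integral_mono_of_nonneg (ae_of_all _ fun y => norm_nonneg _)
    (hf.integrable.abs.const_mul B) (ae_of_all _ fun y => ?_)
  simp only [Real.norm_eq_abs, abs_mul]
  rw [mul_comm]
  exact mul_le_mul_of_nonneg_right (hg _) (abs_nonneg _)

theorem IsTestFun.integrable_corr (hf : IsTestFun f) (hg : IsTestFun g) (μ : Measure (RSpace d))
    [IsFiniteMeasure μ] : Integrable (corr f g) μ := by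
  obtain ⟨B, hB⟩ := hg.bounded
  exact Integrable.of_bound (hf.measurable_corr hg).aestronglyMeasurable _
    (ae_of_all _ fun x => abs_corr_le hf hB x)

/-- The increment form `∫ (f(x + y) - f(y)) (g(x + y) - g(y)) dy`. -/
noncomputable def incr {d : ℕ} (f g : RSpace d → ℝ) (x : RSpace d) : ℝ :=
  ∫ y, (f (x + y) - f y) * (g (x + y) - g y)

theorem IsTestFun.incr_eq (hf : IsTestFun f) (hg : IsTestFun g) (x : RSpace d) :
    incr f g x = 2 * corr f g 0 - (corr f g x + corr g f x) := by
  have h1 := hf.integrable_mul_add hg x x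
  have h2 := hf.integrable_mul_add hg 0 x
  have h3 := hg.integrable_mul_add hf 0 x
  have h4 := hf.integrable_mul_add hg 0 0
  simp only [zero_add] at h2 h3 h4
  have e : (fun y => (f (x + y) - f y) * (g (x + y) - g y)) =
      fun y => (f (x + y) * g (x + y) + f y * g y) - (f y * g (x + y) + g y * f (x + y)) := by
    ext y; ring
  have s1 := integral_sub (h1.add h4) (h2.add h3)
  have s2 := integral_add h1 h4
  have s3 := integral_add h2 h3
  have s4 := integral_add_left_eq_self (μ := volume) (fun y => f y * g y) x
  simp only [Pi.add_apply] at s1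
  rw [incr, e, s1, s2, s3, s4]
  simp only [corr, zero_add]
  ring

end corr

/-! ### The correlation measure -/

namespace SignedRadonMeasure

variable {d : ℕ} (C : SignedRadonMeasure d)

/-- Local finiteness handles the compact unit ball; outside it `‖t‖ ^ d ≥ 1`. -/
theorem isFiniteMeasure_variation (h : ∫⁻ t, (ENNReal.ofReal ‖t‖) ^ d ∂C.variation ≠ ∞) :
    IsFiniteMeasure C.variation := by
  have := C.locallyFinite_pos
  have := C.locallyFinite_neg
  constructor
  have h1 : C.variation (Metric.closedBall 0 1) < ∞ := by
    rw [variation, Measure.add_apply, ENNReal.add_lt_top]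
    exact ⟨(isCompact_closedBall 0 1).measure_lt_top, (isCompact_closedBall 0 1).measure_lt_top⟩
  have h2 : C.variation (Metric.closedBall 0 1)ᶜ < ∞ := by
    refine lt_of_le_of_lt ?_ h.lt_top
    rw [← lintegral_indicator_one Metric.isClosed_closedBall.measurableSet.compl]
    refine lintegral_mono fun t => ?_
    by_cases ht : t ∈ (Metric.closedBall (0 : RSpace d) 1)ᶜ
    · rw [Set.indicator_of_mem ht, Pi.one_apply]
      have : 1 ≤ ‖t‖ := by
        simp only [Set.mem_compl_iff, mem_closedBall_zero_iff, not_le] at ht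
        exact ht.le
      exact one_le_pow₀ (ENNReal.one_le_ofReal.2 this)
    · simp [Set.indicator_of_notMem ht]
  rw [← Set.union_compl_self (Metric.closedBall (0 : RSpace d) 1)]
  exact (measure_union_le _ _).trans_lt (ENNReal.add_lt_top.2 ⟨h1, h2⟩)

theorem isFiniteMeasure_pos [IsFiniteMeasure C.variation] : IsFiniteMeasure C.pos :=
  isFiniteMeasure_of_le C.variation (Measure.le_add_right le_rfl)

theorem isFiniteMeasure_neg [IsFiniteMeasure C.variation] : IsFiniteMeasure C.neg :=
  isFiniteMeasure_of_le C.variation (Measure.le_add_left le_rfl)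

theorem integral_tendsto [IsFiniteMeasure C.variation] {F : ℕ → RSpace d → ℝ} {G : RSpace d → ℝ}
    {B : ℝ} (hF : ∀ n, Measurable (F n)) (hB : ∀ n x, |F n x| ≤ B)
    (hlim : ∀ x, Tendsto (fun n => F n x) atTop (𝓝 (G x))) :
    Tendsto (fun n => C.integral (F n)) atTop (𝓝 (C.integral G)) := by
  have := C.isFiniteMeasure_pos
  have := C.isFiniteMeasure_neg
  refine Tendsto.sub ?_ ?_ <;>
  exact tendsto_integral_of_dominated_convergence (fun _ => B)
    (fun n => (hF n).aestronglyMeasurable) (integrable_const B)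
    (fun n => ae_of_all _ (hB n)) (ae_of_all _ hlim)

theorem abs_integral_le {F : RSpace d → ℝ} {G : RSpace d → ℝ} (hG : Integrable G C.variation)
    (hFG : ∀ x, |F x| ≤ G x) : |C.integral F| ≤ ∫ x, G x ∂C.variation := by
  have h1 : Integrable G C.pos := hG.mono_measure (Measure.le_add_right le_rfl)
  have h2 : Integrable G C.neg := hG.mono_measure (Measure.le_add_left le_rfl)
  rw [variation, integral_add_measure h1 h2, integral]
  exact (abs_sub _ _).trans (add_le_add
    (norm_integral_le_of_norm_le (f := F) h1 (ae_of_all _ hFG))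
    (norm_integral_le_of_norm_le (f := F) h2 (ae_of_all _ hFG)))

theorem integral_const_mul (c : ℝ) (F : RSpace d → ℝ) :
    C.integral (fun x => c * F x) = c * C.integral F := by
  simp only [integral, MeasureTheory.integral_const_mul]
  ring

theorem integral_add [IsFiniteMeasure C.variation] {F G : RSpace d → ℝ}
    (hF : Integrable F C.variation) (hG : Integrable G C.variation) :
    C.integral (fun x => F x + G x) = C.integral F + C.integral G := by
  have l1 : C.pos ≤ C.variation := Measure.le_add_right le_rfl
  have l2 : C.neg ≤ C.variation := Measure.le_add_left le_rfl
  simp only [integral]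
  rw [MeasureTheory.integral_add (hF.mono_measure l1) (hG.mono_measure l1),
    MeasureTheory.integral_add (hF.mono_measure l2) (hG.mono_measure l2)]
  ring

end SignedRadonMeasure

/-! ### Second order structure of the linear statistics -/

namespace RandomSignedMeasure

variable {d : ℕ} {Ω : Type*} [MeasurableSpace Ω] {P : Measure Ω} {M : RandomSignedMeasure d P}
  {C : SignedRadonMeasure d} {f g : RSpace d → ℝ}

theorem I_add (M : RandomSignedMeasure d P) (hf : IsTestFun f) (hg : IsTestFun g) :
    M.I (fun x => f x + g x) =ᵐ[P] M.I f + M.I g := by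
  have h := M.linear 1 1 f g hf hg
  simp only [one_mul] at h
  exact h

theorem I_const_mul (M : RandomSignedMeasure d P) (hf : IsTestFun f) (a : ℝ) :
    M.I (fun x => a * f x) =ᵐ[P] fun ω => a * M.I f ω := by
  have h := M.linear a 0 f f hf hf
  simp only [zero_mul, add_zero] at h
  exact h

theorem I_sub (M : RandomSignedMeasure d P) (hf : IsTestFun f) (hg : IsTestFun g) :
    M.I (fun x => f x - g x) =ᵐ[P] M.I f - M.I g := by
  have h := M.linear 1 (-1) f g hf hg
  simp only [one_mul, neg_one_mul, ← sub_eq_add_neg] at h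
  exact h

theorem IsCorrelationMeasure.covariance_eq (hC : M.IsCorrelationMeasure C) (hf : IsTestFun f)
    (hg : IsTestFun g) : cov[M.I f, M.I g; P] = C.integral (corr f g) :=
  hC f g hf hg

theorem IsCorrelationMeasure.variance_eq (hC : M.IsCorrelationMeasure C) (hf : IsTestFun f) :
    Var[M.I f; P] = C.integral (corr f f) := by
  rw [← hC.covariance_eq hf hf, covariance_self (M.memLp f hf).aestronglyMeasurable.aemeasurable]

theorem variance_const_mul (M : RandomSignedMeasure d P) (hf : IsTestFun f) (a : ℝ) :
    Var[M.I (fun x => a * f x); P] = a ^ 2 * Var[M.I f; P] := by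
  rw [variance_congr (M.I_const_mul hf a), ProbabilityTheory.variance_const_mul]

theorem variance_add [IsProbabilityMeasure P] (M : RandomSignedMeasure d P)
    (hf : IsTestFun f) (hg : IsTestFun g) :
    Var[M.I (fun x => f x + g x); P] =
      Var[M.I f; P] + 2 * cov[M.I f, M.I g; P] + Var[M.I g; P] := by
  rw [variance_congr (M.I_add hf hg), ProbabilityTheory.variance_add (M.memLp f hf) (M.memLp g hg)]

theorem variance_sub_le [IsProbabilityMeasure P] (M : RandomSignedMeasure d P)
    (hf : IsTestFun f) (hg : IsTestFun g) :
    Var[M.I (fun x => f x - g x); P] ≤ 2 * Var[M.I f; P] + 2 * Var[M.I g; P] := by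
  have h1 := ProbabilityTheory.variance_add (M.memLp f hf) (M.memLp g hg)
  have h2 := ProbabilityTheory.variance_sub (M.memLp f hf) (M.memLp g hg)
  have h3 := variance_nonneg (M.I f + M.I g) P
  rw [variance_congr (M.I_sub hf hg)]
  linarith

/-- The autocorrelation of `1_S` never exceeds the volume of `S`. This makes statistics of sets of
small volume nearly deterministic. -/
theorem IsCorrelationMeasure.variance_indicator_le [IsFiniteMeasure C.variation]
    (hC : M.IsCorrelationMeasure C) {S : Set (RSpace d)} (hS : MeasurableSet S)
    (hb : Bornology.IsBounded S) :
    Var[M.I (S.indicator fun _ => 1); P] ≤ volume.real S * C.variation.real Set.univ := by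
  have ht := IsTestFun.indicator hS hb
  rw [hC.variance_eq ht]
  have h0 : ∀ x, |S.indicator (fun _ => (1 : ℝ)) x| = S.indicator (fun _ => (1 : ℝ)) x := fun x =>
    abs_of_nonneg (Set.indicator_nonneg (fun _ _ => zero_le_one) x)
  have h1 : ∀ x, |S.indicator (fun _ => (1 : ℝ)) x| ≤ 1 := fun x => by
    by_cases hx : x ∈ S <;> simp [hx]
  refine (le_abs_self _).trans ((C.abs_integral_le (integrable_const (volume.real S))
    fun x => ?_).trans ?_)
  · refine (abs_corr_le ht h1 x).trans ?_
    simp only [h0, one_mul, integral_indicator_const (1 : ℝ) hS, smul_eq_mul, mul_one, le_refl]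
  · simp [mul_comm]

/-- Hyperuniformity means that the correlation measure, when finite, has total mass zero. -/
theorem IsHyperuniform.integral_one_eq_zero [IsFiniteMeasure C.variation] (hd : 0 < d)
    (hM : M.IsHyperuniform) (hC : M.IsCorrelationMeasure C) : C.integral (fun _ => 1) = 0 := by
  have : Nonempty (Fin d) := ⟨⟨0, hd⟩⟩
  let u : ℕ → RSpace d → ℝ := fun n => (Metric.ball (0 : RSpace d) n).indicator fun _ => 1
  let v : ℕ → ℝ := fun n => volume.real (Metric.ball (0 : RSpace d) n)
  have hu : ∀ n, IsTestFun (u n) := fun n => .indicator measurableSet_ball Metric.isBounded_ball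
  have hv0 : ∀ n, 0 ≤ v n := fun n => measureReal_nonneg
  have hcorr : ∀ n x, corr (u n) (u n) x =
      volume.real (Metric.ball (0 : RSpace d) n ∩ {y | x + y ∈ Metric.ball (0 : RSpace d) n}) := by
    intro n x
    have hm : MeasurableSet {y | x + y ∈ Metric.ball (0 : RSpace d) n} :=
      (measurable_const_add x) measurableSet_ball
    rw [← mul_one (volume.real _), ← smul_eq_mul,
      ← integral_indicator_const (1 : ℝ) (measurableSet_ball.inter hm), corr]
    congr 1
    ext y
    have h := Set.inter_indicator_mul (s := Metric.ball (0 : RSpace d) n)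
      (t := {y | x + y ∈ Metric.ball (0 : RSpace d) n}) (fun _ => (1 : ℝ)) (fun _ => 1) y
    rw [mul_one] at h
    exact h.symm
  have hnn : ∀ n x, 0 ≤ corr (u n) (u n) x := fun n x => by rw [hcorr]; exact measureReal_nonneg
  have hle : ∀ n x, corr (u n) (u n) x ≤ v n := fun n x => by
    rw [hcorr]
    exact measureReal_mono Set.inter_subset_left measure_ball_lt_top.ne
  have hball : ∀ r : ℝ, 0 ≤ r → volume.real (Metric.ball (0 : RSpace d) r) =
      r ^ d * volume.real (Metric.ball (0 : RSpace d) 1) := fun r hr => by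
    rw [Measure.real, Measure.addHaar_ball _ _ hr, finrank_euclideanSpace_fin, ENNReal.toReal_mul,
      ENNReal.toReal_ofReal (pow_nonneg hr d), Measure.real]
  have h1pos : 0 < volume.real (Metric.ball (0 : RSpace d) 1) :=
    ENNReal.toReal_pos (Metric.measure_ball_pos _ _ one_pos).ne' measure_ball_lt_top.ne
  -- The overlap of a ball with its translate by a fixed vector is asymptotically the full ball: it
  -- contains the concentric ball of radius `n - ‖x‖`. Dominated convergence then identifies the
  -- limit of the variance ratios with the total mass of `C`.
  have hlim : ∀ x, Tendsto (fun n => (v n)⁻¹ * corr (u n) (u n) x) atTop (𝓝 1) := by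
    intro x
    have hlow : Tendsto (fun n : ℕ => (1 - ‖x‖ / n) ^ d) atTop (𝓝 1) := by
      have := ((tendsto_const_div_atTop_nhds_zero_nat ‖x‖).const_sub 1).pow d
      simpa using this
    refine tendsto_of_tendsto_of_tendsto_of_le_of_le' hlow tendsto_const_nhds ?_ ?_
    · filter_upwards [eventually_gt_atTop ⌈‖x‖⌉₊] with n hn
      have hxn : ‖x‖ < n := Nat.lt_of_ceil_lt hn
      have hn0 : (0 : ℝ) < n := (norm_nonneg x).trans_lt hxn
      have hsub : Metric.ball (0 : RSpace d) (n - ‖x‖) ⊆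
          Metric.ball (0 : RSpace d) n ∩ {y | x + y ∈ Metric.ball (0 : RSpace d) n} := by
        intro y hy
        simp only [mem_ball_zero_iff, Set.mem_inter_iff, Set.mem_ofPred_eq] at hy ⊢
        exact ⟨by linarith [norm_nonneg x], by linarith [norm_add_le x y]⟩
      have h3 := measureReal_mono (μ := volume) hsub
        (measure_ne_top_of_subset Set.inter_subset_left measure_ball_lt_top.ne)
      rw [← hcorr, hball _ (sub_nonneg.2 hxn.le)] at h3
      rw [show v n = (n : ℝ) ^ d * volume.real (Metric.ball (0 : RSpace d) 1) from
        hball n hn0.le, inv_mul_eq_div, le_div_iff₀ (by positivity)]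
      refine le_trans (le_of_eq ?_) h3
      rw [← mul_assoc, ← mul_pow]
      congr 2
      field_simp
    · exact Eventually.of_forall fun n => by
        rw [inv_mul_eq_div]
        exact div_le_one_of_le₀ (hle n x) (hv0 n)
  have hlim2 := C.integral_tendsto (B := 1)
    (fun n => ((hu n).measurable_corr (hu n)).const_mul (v n)⁻¹) (fun n x => by
      rw [abs_of_nonneg (mul_nonneg (inv_nonneg.2 (hv0 n)) (hnn n x)), inv_mul_eq_div]
      exact div_le_one_of_le₀ (hle n x) (hv0 n)) hlim
  refine tendsto_nhds_unique hlim2 ?_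
  have h4 := hM.comp (tendsto_natCast_atTop_atTop (R := ℝ))
  refine h4.congr fun n => ?_
  rw [C.integral_const_mul, ← hC.variance_eq (hu n), inv_mul_eq_div]
  rfl

/-- Symmetry of the covariance allows averaging `corr f g` and `corr g f`; by `incr_eq` this average
differs from `-(1/2) * incr f g` by a constant, whose integral is zero. -/
theorem IsCorrelationMeasure.covariance_eq_incr [IsFiniteMeasure C.variation]
    (hC : M.IsCorrelationMeasure C) (h0 : C.integral (fun _ => 1) = 0) (hf : IsTestFun f)
    (hg : IsTestFun g) : cov[M.I f, M.I g; P] = C.integral fun x => -(1 / 2) * incr f g x := by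
  have h1 := hC.covariance_eq hf hg
  have h2 := hC.covariance_eq hg hf
  rw [covariance_comm] at h2
  have e : (fun x => -(1 / 2) * incr f g x) = fun x =>
      (1 / 2) * (corr f g x + corr g f x) + -(corr f g 0) * (fun _ => (1 : ℝ)) x := by
    ext x
    rw [hf.incr_eq hg]
    ring
  have i1 := (hf.integrable_corr hg C.variation)
  have i2 := (hg.integrable_corr hf C.variation)
  have s1 := C.integral_add ((i1.add i2).const_mul (1 / 2))
    ((integrable_const (1 : ℝ)).const_mul (-(corr f g 0)))
  simp only [Pi.add_apply] at s1
  rw [e, s1, C.integral_const_mul, C.integral_const_mul, h0, C.integral_add i1 i2, ← h1, ← h2]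
  ring

end RandomSignedMeasure

/-! ### Cut-off functions -/

/-- The radial cut-off, equal to one on the ball of radius `R` and vanishing outside the ball of
radius `2 * R`. -/
noncomputable def cutoff (d : ℕ) (R : ℝ) (x : RSpace d) : ℝ := max 0 (min 1 (2 - ‖x‖ / R))

section cutoff

variable {d : ℕ} {R : ℝ}

theorem cutoff_nonneg (x : RSpace d) : 0 ≤ cutoff d R x := le_max_left _ _

theorem cutoff_le_one (x : RSpace d) : cutoff d R x ≤ 1 := max_le zero_le_one (min_le_left _ _)

theorem cutoff_eq_one (hR : 0 < R) {x : RSpace d} (hx : ‖x‖ ≤ R) : cutoff d R x = 1 := by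
  have : ‖x‖ / R ≤ 1 := (div_le_one hR).2 hx
  rw [cutoff, min_eq_left (by linarith), max_eq_right zero_le_one]

theorem cutoff_eq_zero (hR : 0 < R) {x : RSpace d} (hx : 2 * R ≤ ‖x‖) : cutoff d R x = 0 := by
  have : 2 ≤ ‖x‖ / R := (le_div_iff₀ hR).2 hx
  rw [cutoff, max_eq_left]
  exact (min_le_right _ _).trans (by linarith)

theorem continuous_cutoff : Continuous (cutoff d R) := by
  unfold cutoff
  fun_prop

theorem isTestFun_cutoff (hR : 0 < R) : IsTestFun (cutoff d R) := by
  refine ⟨continuous_cutoff.measurable, ⟨1, fun x => ?_⟩, ?_⟩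
  · rw [abs_of_nonneg (cutoff_nonneg x)]
    exact cutoff_le_one x
  · refine HasCompactSupport.of_support_subset_isCompact (isCompact_closedBall 0 (2 * R)) ?_
    intro x hx
    rw [mem_closedBall_zero_iff]
    by_contra! h
    exact hx (cutoff_eq_zero hR h.le)

theorem abs_cutoff_sub_le_one (x y : RSpace d) : |cutoff d R x - cutoff d R y| ≤ 1 := by
  rw [abs_sub_le_iff]
  constructor <;> linarith [cutoff_nonneg (R := R) x, cutoff_nonneg (R := R) y,
    cutoff_le_one (R := R) x, cutoff_le_one (R := R) y]

theorem abs_cutoff_add_sub_le (hR : 0 < R) (x y : RSpace d) :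
    |cutoff d R (x + y) - cutoff d R y| ≤ ‖x‖ / R := by
  have h1 : |cutoff d R (x + y) - cutoff d R y| ≤ |(2 - ‖x + y‖ / R) - (2 - ‖y‖ / R)| := by
    refine (abs_max_sub_max_le_max _ _ _ _).trans (max_le (by simp) ?_)
    exact (abs_min_sub_min_le_max _ _ _ _).trans (max_le (by simp) le_rfl)
  refine h1.trans ?_
  rw [sub_sub_sub_cancel_left, ← sub_div, abs_div, abs_of_pos hR]
  gcongr
  have := abs_norm_sub_norm_le y (x + y)
  simpa using this

/-- Increments of cut-offs are bounded by `‖x‖ ^ d`, uniformly in the radius. -/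
theorem incr_cutoff_le (hd : d = 1 ∨ d = 2) (hR : 0 < R) (x : RSpace d) :
    |incr (cutoff d R) (cutoff d R) x| ≤
      (2 * 2 ^ d * volume.real (Metric.closedBall (0 : RSpace d) 1)) * ‖x‖ ^ d := by
  set c := volume.real (Metric.closedBall (0 : RSpace d) 1) with hc
  set t : ℝ := min 1 (‖x‖ / R) with ht
  have ht0 : 0 ≤ t := le_min zero_le_one (by positivity)
  let B : Set (RSpace d) := Metric.closedBall 0 (2 * R)
  let S : Set (RSpace d) := B ∪ {y | x + y ∈ B}
  have hBm : MeasurableSet B := Metric.isClosed_closedBall.measurableSet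
  have hB'm : MeasurableSet {y | x + y ∈ B} := (measurable_const_add x) hBm
  have hB : volume B =
      ENNReal.ofReal ((2 * R) ^ d) * volume (Metric.closedBall (0 : RSpace d) 1) := by
    rw [Measure.addHaar_closedBall' _ _ (by positivity), finrank_euclideanSpace_fin]
  have hBr : volume.real B = (2 * R) ^ d * c := by
    rw [Measure.real, hB, ENNReal.toReal_mul, ENNReal.toReal_ofReal (by positivity)]
    rfl
  have hBt : volume {y | x + y ∈ B} = volume B := measure_preimage_add volume x B
  have hBfin : volume B ≠ ∞ := measure_closedBall_lt_top.ne
  have hSfin : volume S ≠ ∞ :=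
    ((measure_union_le _ _).trans_lt (ENNReal.add_lt_top.2
      ⟨hBfin.lt_top, hBt ▸ hBfin.lt_top⟩)).ne
  have hSr : volume.real S ≤ 2 * ((2 * R) ^ d * c) := by
    refine (measureReal_union_le _ _).trans (le_of_eq ?_)
    rw [Measure.real, Measure.real, hBt]
    change volume.real B + volume.real B = _
    rw [hBr]; ring
  have hbound : ∀ y, ‖(cutoff d R (x + y) - cutoff d R y) * (cutoff d R (x + y) - cutoff d R y)‖ ≤
      S.indicator (fun _ => t ^ 2) y := by
    intro y
    by_cases hy : y ∈ S
    · rw [Set.indicator_of_mem hy, norm_mul, ← sq, Real.norm_eq_abs]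
      exact pow_le_pow_left₀ (abs_nonneg _)
        (le_min (abs_cutoff_sub_le_one _ _) (abs_cutoff_add_sub_le hR x y)) 2
    · have h1 : y ∉ B := fun h => hy (Or.inl h)
      have h2 : x + y ∉ B := fun h => hy (Or.inr h)
      simp only [B, mem_closedBall_zero_iff, not_le] at h1 h2
      simp [Set.indicator_of_notMem hy, cutoff_eq_zero hR h1.le, cutoff_eq_zero hR h2.le]
  have hint : Integrable (S.indicator fun _ => t ^ 2) (volume : Measure (RSpace d)) :=
    (integrable_indicator_iff (hBm.union hB'm)).2 (integrableOn_const hSfin)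
  have h1 := norm_integral_le_of_norm_le hint (ae_of_all _ hbound)
  rw [integral_indicator_const _ (hBm.union hB'm), smul_eq_mul] at h1
  refine h1.trans ((mul_le_mul_of_nonneg_right hSr (sq_nonneg t)).trans ?_)
  -- Here `d ≤ 2` enters: the squared increment must absorb the volume factor `R ^ d`. For `d = 1`
  -- one factor `t ≤ 1` is discarded; for `d = 2` both are used.
  have h2 : R ^ d * t ^ 2 ≤ ‖x‖ ^ d := by
    have htx : R * t ≤ ‖x‖ := by
      calc R * t ≤ R * (‖x‖ / R) := by gcongr; exact min_le_right _ _
        _ = ‖x‖ := by field_simp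
    rcases hd with rfl | rfl
    · have : t ≤ 1 := min_le_left _ _
      nlinarith [mul_nonneg hR.le ht0]
    · rw [← mul_pow]
      exact pow_le_pow_left₀ (by positivity) htx 2
  have hc0 : 0 ≤ c := measureReal_nonneg
  calc 2 * ((2 * R) ^ d * c) * t ^ 2 = (2 * 2 ^ d * c) * (R ^ d * t ^ 2) := by rw [mul_pow]; ring
    _ ≤ _ := by gcongr

/-- The bound `b` is left free: `b = 1` provides domination uniformly in `R`, and `b = ‖x‖ / R`
provides pointwise decay. -/
theorem abs_incr_cutoff_le {f : RSpace d → ℝ} (hf : IsTestFun f) {b : ℝ} (x : RSpace d)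
    (hb : ∀ y, |cutoff d R (x + y) - cutoff d R y| ≤ b) :
    |incr f (cutoff d R) x| ≤ (2 * ∫ y, |f y|) * b := by
  have i0 := hf.integrable.abs
  have i1 := i0.comp_add_left x
  have i2 : Integrable fun y => (|f (x + y)| + |f y|) * b := (i1.add i0).mul_const b
  have h := norm_integral_le_of_norm_le
    (f := fun y => (f (x + y) - f y) * (cutoff d R (x + y) - cutoff d R y)) i2
    (ae_of_all _ fun y => by
      rw [norm_mul]
      exact mul_le_mul (abs_sub _ _) (hb y) (norm_nonneg _) (by positivity))
  refine h.trans (le_of_eq ?_)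
  rw [integral_mul_const, integral_add i1 i0, integral_add_left_eq_self (fun y => |f y|) x]
  ring

theorem measurable_incr {f g : RSpace d → ℝ} (hf : IsTestFun f) (hg : IsTestFun g) :
    Measurable (incr f g) := by
  have e : incr f g = fun x => 2 * corr f g 0 - (corr f g x + corr g f x) :=
    funext fun x => hf.incr_eq hg x
  rw [e]
  exact measurable_const.sub ((hf.measurable_corr hg).add (hg.measurable_corr hf))

end cutoff

/-! ### Bounded variance and asymptotic decorrelation of cut-off statistics -/

namespace RandomSignedMeasure

variable {d : ℕ} {Ω : Type*} [MeasurableSpace Ω] {P : Measure Ω} {M : RandomSignedMeasure d P}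
  {C : SignedRadonMeasure d} {f g : RSpace d → ℝ}

theorem IsCorrelationMeasure.exists_variance_cutoff_le [IsFiniteMeasure C.variation]
    (hC : M.IsCorrelationMeasure C) (hd : d = 1 ∨ d = 2) (h0 : C.integral (fun _ => 1) = 0)
    (hmom : ∫⁻ t, (ENNReal.ofReal ‖t‖) ^ d ∂C.variation ≠ ∞) :
    ∃ K : ℝ, ∀ R, 0 < R → Var[M.I (cutoff d R); P] ≤ K := by
  have hint : Integrable (fun t => ‖t‖ ^ d) C.variation := by
    refine ⟨(continuous_norm.pow d).aestronglyMeasurable, ?_⟩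
    rw [hasFiniteIntegral_iff_ofReal (ae_of_all _ fun t => by positivity)]
    simpa only [ENNReal.ofReal_pow (norm_nonneg _)] using hmom.lt_top
  refine ⟨∫ t, (2 * 2 ^ d * volume.real (Metric.closedBall (0 : RSpace d) 1)) * ‖t‖ ^ d
    ∂C.variation, fun R hR => ?_⟩
  have ht := isTestFun_cutoff (d := d) hR
  rw [← covariance_self (M.memLp _ ht).aestronglyMeasurable.aemeasurable,
    hC.covariance_eq_incr h0 ht ht, C.integral_const_mul]
  have h := C.abs_integral_le (hint.const_mul _) (incr_cutoff_le hd hR)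
  have h2 := neg_abs_le (C.integral (incr (cutoff d R) (cutoff d R)))
  have h3 : -(1 / 2) * C.integral (incr (cutoff d R) (cutoff d R)) ≤
    |C.integral (incr (cutoff d R) (cutoff d R))| := by
    linarith [abs_nonneg (C.integral (incr (cutoff d R) (cutoff d R)))]
  exact h3.trans h

/-- For fixed `f`, `incr f χ_R` is bounded uniformly in `R` and tends to zero pointwise, so
dominated convergence applies under the finite measure `|C|`. -/
theorem IsCorrelationMeasure.tendsto_covariance_cutoff [IsFiniteMeasure C.variation]
    (hC : M.IsCorrelationMeasure C) (h0 : C.integral (fun _ => 1) = 0) (hf : IsTestFun f) :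
    Tendsto (fun n : ℕ => cov[M.I f, M.I (cutoff d (n + 1)); P]) atTop (𝓝 0) := by
  have hpos : ∀ n : ℕ, (0 : ℝ) < n + 1 := fun n => by positivity
  have ht := fun n : ℕ => isTestFun_cutoff (d := d) (hpos n)
  have h := C.integral_tendsto (F := fun n : ℕ => incr f (cutoff d (n + 1))) (G := fun _ => 0)
    (fun n => measurable_incr hf (ht n))
    (fun n x => abs_incr_cutoff_le hf x fun y => abs_cutoff_sub_le_one _ _) (fun x => by
      refine squeeze_zero_norm
        (fun n => abs_incr_cutoff_le hf x fun y => abs_cutoff_add_sub_le (hpos n) x y) ?_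
      have h1 : Tendsto (fun n : ℕ => ‖x‖ / ((n : ℝ) + 1)) atTop (𝓝 0) :=
        tendsto_const_nhds.div_atTop
          (tendsto_atTop_add_const_right _ _ tendsto_natCast_atTop_atTop)
      simpa using h1.const_mul (2 * ∫ y, |f y|))
  have h2 := h.const_mul (-(1 / 2))
  have h3 : C.integral (fun _ => 0) = 0 := by simp [SignedRadonMeasure.integral]
  rw [h3, mul_zero] at h2
  refine h2.congr fun n => ?_
  rw [hC.covariance_eq_incr h0 hf (ht n), C.integral_const_mul]

variable [IsProbabilityMeasure P]

/-- Sums of `k` cut-offs of sufficiently different sizes have variance of order `k`. -/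
theorem exists_sum_cutoff (M : RandomSignedMeasure d P) {K : ℝ}
    (hK : ∀ R, 0 < R → Var[M.I (cutoff d R); P] ≤ K)
    (hcov : ∀ f, IsTestFun f →
      Tendsto (fun n : ℕ => cov[M.I f, M.I (cutoff d (n + 1)); P]) atTop (𝓝 0))
    (r : ℝ) (k : ℕ) : ∃ F : RSpace d → ℝ, IsTestFun F ∧ (∀ x, ‖x‖ ≤ r → F x = k) ∧
      Var[M.I F; P] ≤ k * (K + 1) := by
  induction k with
  | zero =>
    have ht := isTestFun_cutoff (d := d) one_pos
    refine ⟨fun x => 0 * cutoff d 1 x, ht.const_mul 0, fun x _ => by simp, ?_⟩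
    rw [M.variance_const_mul ht]
    simp
  | succ k ih =>
    obtain ⟨F, hF, hF1, hFv⟩ := ih
    -- With covariance below `1 / 2`, the cross term adds at most one to the variance, so each new
    -- cut-off costs at most `K + 1`.
    have h1 : ∀ᶠ n : ℕ in atTop, cov[M.I F, M.I (cutoff d (n + 1)); P] < 1 / 2 :=
      (hcov F hF).eventually_lt_const (by norm_num)
    obtain ⟨n, hn, hnr⟩ := (h1.and (eventually_ge_atTop ⌈r⌉₊)).exists
    have hR : (0 : ℝ) < n + 1 := by positivity
    have hrn : r ≤ n := Nat.ceil_le.1 hnr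
    have ht := isTestFun_cutoff (d := d) hR
    refine ⟨fun x => F x + cutoff d (n + 1) x, hF.add ht, fun x hx => ?_, ?_⟩
    · simp only [hF1 x hx, cutoff_eq_one hR (hx.trans (by linarith)), Nat.cast_succ]
    · rw [M.variance_add hF ht]
      push_cast
      linarith [hK _ hR]

/-- Functions equal to one on a given ball, with centred linear statistics of small variance. -/
theorem exists_centred_one_on_ball (hd : 0 < d) (hM : M.IsWideSenseStationary) {K : ℝ}
    (hK : ∀ R, 0 < R → Var[M.I (cutoff d R); P] ≤ K)
    (hcov : ∀ f, IsTestFun f →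
      Tendsto (fun n : ℕ => cov[M.I f, M.I (cutoff d (n + 1)); P]) atTop (𝓝 0))
    (r : ℝ) {ε : ℝ} (hε : 0 < ε) : ∃ φ : RSpace d → ℝ, IsTestFun φ ∧
      (∀ x, ‖x‖ ≤ r → φ x = 1) ∧ ∫ ω, M.I φ ω ∂P = 0 ∧ Var[M.I φ; P] ≤ ε := by
  -- The difference of `F` and its translate has variance at most `4 * k * (K + 1)`; dividing by `k
  -- ^ 2` must leave at most `ε`.
  obtain ⟨k, hk⟩ := exists_nat_gt (4 * (K + 1) / ε)
  have hK0 : 0 ≤ K := (variance_nonneg _ _).trans (hK 1 one_pos)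
  have hk0 : (0 : ℝ) < k := lt_of_le_of_lt (by positivity) hk
  obtain ⟨F, hF, hF1, hFv⟩ := M.exists_sum_cutoff hK hcov r k
  obtain ⟨s, hs⟩ := hF.compactSupport.isBounded.subset_closedBall (0 : RSpace d)
  -- The shift is long enough for the translated support to miss the ball of radius `r`.
  obtain ⟨v, hv⟩ : ∃ v : RSpace d, |r| + |s| + 1 ≤ ‖v‖ :=
    ⟨EuclideanSpace.single ⟨0, hd⟩ (|r| + |s| + 1), by simpa using le_abs_self _⟩
  have hFt := hF.translate v
  have hst := hM F v hF
  have hD : IsTestFun fun x => F x - F (x - v) := by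
    simpa only [one_mul, neg_one_mul, ← sub_eq_add_neg] using hF.lincomb hFt 1 (-1)
  refine ⟨fun x => (k : ℝ)⁻¹ * (F x - F (x - v)), hD.const_mul _, fun x hx => ?_, ?_, ?_⟩
  · have h1 : F (x - v) = 0 := by
      by_contra h
      have h2 := hs (subset_tsupport F h)
      rw [mem_closedBall_zero_iff] at h2
      have h3 := norm_sub_norm_le v x
      rw [norm_sub_rev] at h3
      linarith [le_abs_self r, le_abs_self s]
    simp only [hF1 x hx, h1, sub_zero, inv_mul_cancel₀ hk0.ne']
  · rw [integral_congr_ae (M.I_const_mul hD _), integral_const_mul,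
      integral_congr_ae (M.I_sub hF hFt)]
    have := integral_sub ((M.memLp F hF).integrable one_le_two)
      ((M.memLp _ hFt).integrable one_le_two)
    simp only [Pi.sub_apply]
    rw [this, hst.1, sub_self, mul_zero]
  · rw [M.variance_const_mul hD]
    have h1 := M.variance_sub_le hF hFt
    rw [hst.2] at h1
    have h2 : Var[M.I (fun x => F x - F (x - v)); P] ≤ k * (4 * (K + 1)) := by linarith
    rw [div_lt_iff₀ hε] at hk
    calc ((k : ℝ)⁻¹) ^ 2 * Var[M.I (fun x => F x - F (x - v)); P]
        ≤ ((k : ℝ)⁻¹) ^ 2 * (k * (4 * (K + 1))) := by gcongr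
      _ ≤ ((k : ℝ)⁻¹) ^ 2 * (k * (k * ε)) := by gcongr
      _ = ε := by field_simp

end RandomSignedMeasure

/-! ### The mean measure -/

/-- By Chebyshev, `X n` is close to its mean with high probability; it is also close to zero with
high probability. Once both exceptional probabilities sum to less than one, some `ω` satisfies both,
and the mean is small. -/
theorem tendsto_integral_of_tendstoInMeasure_of_variance {Ω : Type*} [MeasurableSpace Ω]
    {P : Measure Ω} [IsProbabilityMeasure P] {X : ℕ → Ω → ℝ} (hX : ∀ n, MemLp (X n) 2 P)
    (hlim : TendstoInMeasure P X atTop fun _ => 0)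
    (hvar : Tendsto (fun n => Var[X n; P]) atTop (𝓝 0)) :
    Tendsto (fun n => ∫ ω, X n ω ∂P) atTop (𝓝 0) := by
  rw [Metric.tendsto_atTop']
  intro ε hε
  have h1 : Tendsto (fun n => P {ω | ε / 2 ≤ ‖X n ω - 0‖}) atTop (𝓝 0) :=
    tendstoInMeasure_iff_norm.1 hlim (ε / 2) (by positivity)
  have h2 : Tendsto (fun n => ENNReal.ofReal (Var[X n; P] / (ε / 2) ^ 2)) atTop (𝓝 0) := by
    have := ENNReal.tendsto_ofReal (hvar.div_const ((ε / 2) ^ 2))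
    simpa using this
  have h3 := h1.add h2
  rw [add_zero] at h3
  obtain ⟨N, hN⟩ := eventually_atTop.1 (h3.eventually_lt_const one_pos)
  refine ⟨N, fun n hn => ?_⟩
  by_contra! hc
  rw [dist_zero_right] at hc
  have hcover : (Set.univ : Set Ω) ⊆
      {ω | ε / 2 ≤ ‖X n ω - 0‖} ∪ {ω | ε / 2 ≤ |X n ω - ∫ ω, X n ω ∂P|} := by
    intro ω _
    by_contra h
    simp only [Set.mem_union, Set.mem_ofPred_eq, not_or, not_le, sub_zero, Real.norm_eq_abs] at h
    have h4 := abs_sub (X n ω) (X n ω - ∫ ω, X n ω ∂P)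
    rw [sub_sub_cancel] at h4
    rw [Real.norm_eq_abs] at hc
    linarith [h.1, h.2]
  have h5 := (measure_mono (μ := P) hcover).trans (measure_union_le _ _)
  rw [measure_univ] at h5
  have h6 := meas_ge_le_variance_div_sq (hX n) (half_pos hε)
  exact absurd (h5.trans (add_le_add le_rfl h6)) (not_le.2 (hN n hn.le))

theorem MeasureTheory.SignedMeasure.abs_apply_le_totalVariation {α : Type*}
    [MeasurableSpace α] (s : SignedMeasure α) {S : Set α} (hS : MeasurableSet S) :
    |s S| ≤ s.totalVariation.real S := by
  rw [s.apply_eq_posPart_real_sub_negPart_real hS, SignedMeasure.totalVariation,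
    measureReal_add_apply]
  refine (abs_sub _ _).trans (le_of_eq ?_)
  rw [abs_of_nonneg measureReal_nonneg, abs_of_nonneg measureReal_nonneg]

namespace RandomSignedMeasure

variable {d : ℕ} {Ω : Type*} [MeasurableSpace Ω] {P : Measure Ω} {M : RandomSignedMeasure d P}
  {C : SignedRadonMeasure d} [IsProbabilityMeasure P]

/-- Countable additivity sends the statistics of the tails `T N` to zero only in probability. Their
volumes also vanish, hence so do their variances, which upgrades this to convergence of means. -/
theorem tendsto_mean_of_tendsto_volume [IsFiniteMeasure C.variation]
    (hC : M.IsCorrelationMeasure C) {A : ℕ → Set (RSpace d)} (hA : ∀ n, MeasurableSet (A n))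
    (hdis : Pairwise (Function.onFun Disjoint A)) (hb : Bornology.IsBounded (⋃ n, A n)) :
    Tendsto (fun N => ∑ n ∈ Finset.range N, ∫ ω, M.I ((A n).indicator fun _ => 1) ω ∂P) atTop
      (𝓝 (∫ ω, M.I ((⋃ n, A n).indicator fun _ => 1) ω ∂P)) := by
  let T : ℕ → Set (RSpace d) := fun N => ⋃ k, A (k + N)
  have hTm : ∀ N, MeasurableSet (T N) := fun N => .iUnion fun k => hA _
  have hTb : ∀ N, Bornology.IsBounded (T N) := fun N =>
    hb.subset (Set.iUnion_subset fun k => Set.subset_iUnion A _)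
  have hAb : ∀ n, Bornology.IsBounded (A n) := fun n => hb.subset (Set.subset_iUnion A n)
  have hAt := fun n => IsTestFun.indicator (hA n) (hAb n)
  have hTt := fun n => IsTestFun.indicator (hTm n) (hTb n)
  have hT0 : T 0 = ⋃ n, A n := by simp [T]
  have hTsucc : ∀ N, T N = A N ∪ T (N + 1) := fun N => by
    ext x
    simp only [T, Set.mem_iUnion, Set.mem_union]
    constructor
    · rintro ⟨_ | k, hk⟩
      · exact Or.inl (by simpa using hk)
      · exact Or.inr ⟨k, by rwa [add_right_comm] at hk⟩
    · rintro (h | ⟨k, hk⟩)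
      · exact ⟨0, by simpa using h⟩
      · exact ⟨k + 1, by rwa [add_right_comm]⟩
  have hTdis : ∀ N, Disjoint (A N) (T (N + 1)) := fun N =>
    Set.disjoint_iUnion_right.2 fun k => hdis (by omega)
  have hTI : ∀ N, M.I ((T N).indicator fun _ => 1) =ᵐ[P]
      M.I ((A N).indicator fun _ => 1) + M.I ((T (N + 1)).indicator fun _ => 1) := fun N => by
    have e : ((T N).indicator fun _ => (1 : ℝ)) = fun x =>
        (A N).indicator (fun _ => 1) x + (T (N + 1)).indicator (fun _ => 1) x := by
      rw [hTsucc N, Set.indicator_union_of_disjoint (hTdis N)]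
    rw [e]
    exact M.I_add (hAt N) (hTt (N + 1))
  have hsum : ∀ N, (fun ω => M.I ((⋃ n, A n).indicator fun _ => 1) ω) =ᵐ[P] fun ω =>
      (∑ n ∈ Finset.range N, M.I ((A n).indicator fun _ => 1) ω) +
        M.I ((T N).indicator fun _ => 1) ω := by
    intro N
    induction N with
    | zero => simp [hT0]
    | succ N ih =>
      filter_upwards [ih, hTI N] with ω h1 h2
      rw [h1, h2, Finset.sum_range_succ, Pi.add_apply, add_assoc]
  have hvol : Tendsto (fun N => volume.real (T N)) atTop (𝓝 0) := by
    have hfin : ∑' n, volume (A n) ≠ ∞ := by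
      rw [← measure_iUnion hdis hA]
      exact hb.measure_lt_top.ne
    have h1 : Tendsto (fun N => volume (T N)) atTop (𝓝 0) :=
      tendsto_of_tendsto_of_tendsto_of_le_of_le tendsto_const_nhds
        (ENNReal.tendsto_sum_nat_add _ hfin) (fun _ => zero_le) fun N => measure_iUnion_le _
    exact (ENNReal.tendsto_toReal ENNReal.zero_ne_top).comp h1
  have hvar : Tendsto (fun N => Var[M.I ((T N).indicator fun _ => 1); P]) atTop (𝓝 0) :=
    squeeze_zero (fun N => variance_nonneg _ _)
      (fun N => hC.variance_indicator_le (hTm N) (hTb N))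
      (by simpa using hvol.mul_const (C.variation.real Set.univ))
  have hmeas := M.sigmaAdditive (fun n => (A n).indicator fun _ => 1)
    ((⋃ n, A n).indicator fun _ => 1) hAt (.indicator (.iUnion hA) hb)
    (fun n x => Set.indicator_nonneg (fun _ _ => zero_le_one) x) fun x => by
      by_cases hx : x ∈ ⋃ n, A n
      · obtain ⟨i, hi⟩ := Set.mem_iUnion.1 hx
        rw [Set.indicator_of_mem hx]
        have := hasSum_single (f := fun n => (A n).indicator (fun _ => (1 : ℝ)) x) i fun j hj =>
          Set.indicator_of_notMem (fun h => Set.disjoint_left.1 (hdis hj) h hi) _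
        simpa [Set.indicator_of_mem hi] using this
      · rw [Set.indicator_of_notMem hx]
        have h : ∀ n, x ∉ A n := fun n h => hx (Set.mem_iUnion_of_mem n h)
        simp only [Set.indicator_of_notMem (h _)]
        exact hasSum_zero
  have hmeas' : TendstoInMeasure P (fun N => M.I ((T N).indicator fun _ => 1)) atTop
      fun _ => 0 := by
    rw [tendstoInMeasure_iff_norm] at hmeas ⊢
    intro ε hε
    refine (hmeas ε hε).congr fun N => measure_congr ?_
    filter_upwards [hsum N] with ω hω
    apply propext
    change ε ≤ _ ↔ ε ≤ _
    rw [hω, sub_zero, sub_add_cancel_left, norm_neg]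
  have hlim := tendsto_integral_of_tendstoInMeasure_of_variance
    (fun N => M.memLp _ (hTt N)) hmeas' hvar
  have hI : ∀ {f}, IsTestFun f → Integrable (M.I f) P := fun hf =>
    (M.memLp _ hf).integrable one_le_two
  have h := hlim.const_sub (∫ ω, M.I ((⋃ n, A n).indicator fun _ => 1) ω ∂P)
  rw [sub_zero] at h
  refine h.congr fun N => ?_
  rw [integral_congr_ae (hsum N), integral_add (integrable_finsetSum _ fun n _ => hI (hAt n))
    (hI (hTt N)), integral_finsetSum _ fun n _ => hI (hAt n), add_sub_cancel_right]

/-- On a bounded set the mean of a random signed measure is a finite signed measure. -/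
theorem exists_mean_signedMeasure [IsFiniteMeasure C.variation] (hC : M.IsCorrelationMeasure C)
    {B : Set (RSpace d)} (hB : MeasurableSet B) (hBb : Bornology.IsBounded B) :
    ∃ s : SignedMeasure (RSpace d), ∀ S, MeasurableSet S → S ⊆ B →
      s S = ∫ ω, M.I (S.indicator fun _ => 1) ω ∂P := by
  classical
  let m : Set (RSpace d) → ℝ := fun S => ∫ ω, M.I (S.indicator fun _ => 1) ω ∂P
  have hadd : ∀ A : ℕ → Set (RSpace d), (∀ n, MeasurableSet (A n)) →
      Pairwise (Function.onFun Disjoint A) → (∀ n, A n ⊆ B) →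
      Tendsto (fun N => ∑ n ∈ Finset.range N, m (A n)) atTop (𝓝 (m (⋃ n, A n))) :=
    fun A hA hdis hAB => tendsto_mean_of_tendsto_volume hC hA hdis
      (hBb.subset (Set.iUnion_subset hAB))
  have hm0 : m ∅ = 0 := by
    have ht := IsTestFun.indicator (d := d) MeasurableSet.empty Bornology.isBounded_empty
    have h := integral_congr_ae (M.I_const_mul ht 0)
    simp only [zero_mul, integral_zero] at h
    simpa [m] using h
  -- Convergence of partial sums must become unconditional. Replacing arbitrary terms by `∅` shows
  -- that every subfamily converges, in particular the nonnegative and the negative terms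
  -- separately.
  have hsumm : ∀ A : ℕ → Set (RSpace d), (∀ n, MeasurableSet (A n)) →
      Pairwise (Function.onFun Disjoint A) → (∀ n, A n ⊆ B) → ∀ p : ℕ → Prop,
      ∃ l, Tendsto (fun N => ∑ n ∈ Finset.range N, if p n then m (A n) else 0) atTop (𝓝 l) := by
    intro A hA hdis hAB p
    have h := hadd (fun n => if p n then A n else ∅)
      (fun n => by beta_reduce; split_ifs; exacts [hA n, .empty])
      (fun i j hij => by
        simp only [Function.onFun]
        split_ifs <;> simp [hdis hij])
      (fun n => by split_ifs; exacts [hAB n, Set.empty_subset _])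
    refine ⟨_, h.congr fun N => Finset.sum_congr rfl fun n _ => ?_⟩
    split_ifs
    exacts [rfl, hm0]
  have hsummable : ∀ A : ℕ → Set (RSpace d), (∀ n, MeasurableSet (A n)) →
      Pairwise (Function.onFun Disjoint A) → (∀ n, A n ⊆ B) → Summable fun n => m (A n) := by
    intro A hA hdis hAB
    obtain ⟨l, hl⟩ := hsumm A hA hdis hAB fun n => 0 ≤ m (A n)
    obtain ⟨l', hl'⟩ := hsumm A hA hdis hAB fun n => m (A n) < 0
    have s1 : Summable fun n => if 0 ≤ m (A n) then m (A n) else 0 :=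
      ((hasSum_iff_tendsto_nat_of_nonneg (fun n => by split_ifs with h; exacts [h, le_rfl]) l).2
        hl).summable
    have s2 : Summable fun n => -(if m (A n) < 0 then m (A n) else 0) :=
      ((hasSum_iff_tendsto_nat_of_nonneg (fun n => by
        split_ifs with h
        · exact neg_nonneg.2 h.le
        · simp) (-l')).2
        (by simpa only [Finset.sum_neg_distrib] using hl'.neg)).summable
    refine (s1.sub s2).congr fun n => ?_
    rcases lt_or_ge (m (A n)) 0 with h | h
    · simp [h, not_le.2 h]
    · simp [h, not_lt.2 h]
  refine ⟨⟨fun S => if MeasurableSet S then m (S ∩ B) else 0, by simp [hm0],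
    fun S hS => if_neg hS, fun A hA hdis => ?_⟩, fun S hS hSB => ?_⟩
  · have hA' := fun n => (hA n).inter hB
    have hdis' : Pairwise (Function.onFun Disjoint fun n => A n ∩ B) := fun i j hij =>
      (hdis hij).mono Set.inter_subset_left Set.inter_subset_left
    have hAB : ∀ n, A n ∩ B ⊆ B := fun n => Set.inter_subset_right
    simp only [if_pos (hA _), if_pos (MeasurableSet.iUnion hA), Set.iUnion_inter]
    have hs := (hsummable _ hA' hdis' hAB).hasSum
    rwa [tendsto_nhds_unique hs.tendsto_sum_nat (hadd _ hA' hdis' hAB)] at hs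
  · change (if MeasurableSet S then m (S ∩ B) else 0) = m S
    rw [if_pos hS, Set.inter_eq_left.2 hSB]

/-- Inner approximation by closed sets, in mean and in volume. -/
theorem exists_isClosed_mean_lt [IsFiniteMeasure C.variation] (hC : M.IsCorrelationMeasure C)
    {E : Set (RSpace d)} (hE : MeasurableSet E) (hEb : Bornology.IsBounded E) {δ : ℝ}
    (hδ : 0 < δ) : ∃ K ⊆ E, IsClosed K ∧ volume.real (E \ K) ≤ δ ∧
      |∫ ω, M.I ((E \ K).indicator fun _ => 1) ω ∂P| ≤ δ := by
  obtain ⟨s, hs⟩ := exists_mean_signedMeasure hC hE hEb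
  have : IsFiniteMeasure ((volume : Measure (RSpace d)).restrict E) :=
    ⟨by rw [Measure.restrict_apply_univ]; exact hEb.measure_lt_top⟩
  -- One inner approximation for the sum of both measures controls volume and mean simultaneously.
  let μ := (volume : Measure (RSpace d)).restrict E + s.totalVariation
  obtain ⟨K, hKE, hK, hlt⟩ := hE.exists_isClosed_sdiff_lt (μ := μ) (measure_ne_top _ _)
    (ENNReal.ofReal_pos.2 hδ).ne'
  have hm : MeasurableSet (E \ K) := hE.diff hK.measurableSet
  have hle : μ.real (E \ K) ≤ δ := ENNReal.toReal_le_of_le_ofReal hδ.le hlt.le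
  have hsplit : μ.real (E \ K) = volume.real (E \ K) + s.totalVariation.real (E \ K) := by
    rw [measureReal_add_apply, measureReal_restrict_apply hm, Set.inter_eq_left.2 Set.sdiff_subset]
  have h1 := s.abs_apply_le_totalVariation hm
  rw [hs _ hm Set.sdiff_subset] at h1
  have h2 : 0 ≤ volume.real (E \ K) := measureReal_nonneg
  have h3 : 0 ≤ s.totalVariation.real (E \ K) := measureReal_nonneg
  exact ⟨K, hKE, hK, by linarith, by linarith⟩

end RandomSignedMeasure

/-! ### Number rigidity -/

namespace RandomSignedMeasure

variable {d : ℕ} {Ω : Type*} [MeasurableSpace Ω] {P : Measure Ω} {M : RandomSignedMeasure d P}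
  {C : SignedRadonMeasure d}

/-- Approximation in `L²` suffices: a subsequence converges almost surely and keeps its `L²` limit.
-/
theorem isLinearlyRigid_of_forall_exists (M : RandomSignedMeasure d P) {γ : RSpace d → ℝ}
    (hγ : IsTestFun γ) {A : Set (RSpace d)}
    (hA : ∀ ε : ℝ, 0 < ε → ∃ h : RSpace d → ℝ, IsTestFun h ∧ tsupport h ⊆ Aᶜ ∧
      ∫ ω, (M.I γ ω - M.I h ω) ^ 2 ∂P ≤ ε) : M.IsLinearlyRigid γ A := by
  choose h ht hs hle using fun n : ℕ => hA (1 / ((n : ℝ) + 1)) Nat.one_div_pos_of_nat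
  have hlim : Tendsto (fun n => ∫ ω, (M.I γ ω - M.I (h n) ω) ^ 2 ∂P) atTop (𝓝 0) :=
    squeeze_zero (fun n => integral_nonneg fun ω => sq_nonneg _) hle
      tendsto_one_div_add_atTop_nhds_zero_nat
  have hmem : ∀ n, MemLp (fun ω => M.I γ ω - M.I (h n) ω) 2 P := fun n =>
    (M.memLp γ hγ).sub (M.memLp _ (ht n))
  have hL2 : Tendsto (fun n => eLpNorm (fun ω => M.I γ ω - M.I (h n) ω) 2 P) atTop (𝓝 0) := by
    have h1 : ∀ n, eLpNorm (fun ω => M.I γ ω - M.I (h n) ω) 2 P =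
        ENNReal.ofReal √(∫ ω, (M.I γ ω - M.I (h n) ω) ^ 2 ∂P) := fun n => by
      rw [(hmem n).eLpNorm_eq_integral_rpow_norm two_ne_zero ENNReal.ofNat_ne_top,
        Real.sqrt_eq_rpow]
      simp
    simp only [h1]
    have h2 := ENNReal.tendsto_ofReal ((Real.continuous_sqrt.tendsto 0).comp hlim)
    simpa using h2
  have hL2' : Tendsto (fun n => eLpNorm (M.I (h n) - M.I γ) 2 P) atTop (𝓝 0) :=
    hL2.congr fun n => eLpNorm_sub_comm (M.I γ) (M.I (h n)) 2 P
  obtain ⟨ns, hns, hae⟩ := (tendstoInMeasure_of_tendsto_eLpNorm two_ne_zero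
    (fun n => (M.memLp _ (ht n)).aestronglyMeasurable) (M.memLp γ hγ).aestronglyMeasurable
    hL2').exists_seq_tendsto_ae
  exact ⟨fun n => h (ns n), fun n => ⟨ht _, hs _⟩, hae, hL2.comp hns.tendsto_atTop⟩

variable [IsProbabilityMeasure P]

/-- Up to a small error, the mass of `A` is a linear statistic supported outside `A`. -/
theorem exists_predictor [IsFiniteMeasure C.variation] (hC : M.IsCorrelationMeasure C)
    {A : Set (RSpace d)} (hA : MeasurableSet A) {r : ℝ} (hAr : A ⊆ Metric.ball 0 r)
    (hφ : ∀ ε : ℝ, 0 < ε → ∃ φ : RSpace d → ℝ, IsTestFun φ ∧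
      (∀ x, ‖x‖ ≤ r → φ x = 1) ∧ ∫ ω, M.I φ ω ∂P = 0 ∧ Var[M.I φ; P] ≤ ε)
    {ε : ℝ} (hε : 0 < ε) : ∃ h : RSpace d → ℝ, IsTestFun h ∧ tsupport h ⊆ Aᶜ ∧
      ∫ ω, (M.I (A.indicator fun _ => 1) ω - M.I h ω) ^ 2 ∂P ≤ ε := by
  set V := C.variation.real Set.univ
  have hV : 0 ≤ V := measureReal_nonneg
  -- The error budget is `2 * (ε / 8)` for `φ`, `2 * δ * V` for the variance on `S`, and `δ ^ 2 ≤ δ`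
  -- for the squared mean, in total below `ε`.
  obtain ⟨δ, hδ0, hδ1, hδ⟩ : ∃ δ : ℝ, 0 < δ ∧ δ ≤ 1 ∧ δ * (V + 1) ≤ ε / 4 := by
    refine ⟨min 1 (ε / 4 / (V + 1)), by positivity, min_le_left _ _, ?_⟩
    rw [← le_div_iff₀ (by positivity)]
    exact min_le_right _ _
  obtain ⟨φ, hφt, hφ1, hφm, hφv⟩ := hφ (ε / 8) (by positivity)
  have hE : MeasurableSet (Metric.ball 0 r \ A) := measurableSet_ball.diff hA
  have hEb : Bornology.IsBounded (Metric.ball 0 r \ A) :=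
    Metric.isBounded_ball.subset Set.sdiff_subset
  obtain ⟨K, hKE, hK, hvol, hmean⟩ := exists_isClosed_mean_lt hC hE hEb hδ0
  set S := (Metric.ball 0 r \ A) \ K with hS
  have hSm : MeasurableSet S := hE.diff hK.measurableSet
  have hSb : Bornology.IsBounded S := hEb.subset Set.sdiff_subset
  set u : RSpace d → ℝ := S.indicator fun _ => 1
  have hut : IsTestFun u := .indicator hSm hSb
  set a : RSpace d → ℝ := A.indicator fun _ => 1
  have hat : IsTestFun a := .indicator hA (Metric.isBounded_ball.subset hAr)
  have hψt : IsTestFun fun x => φ x - u x := by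
    simpa only [one_mul, neg_one_mul, ← sub_eq_add_neg] using hφt.lincomb hut 1 (-1)
  have hht : IsTestFun fun x => a x - (φ x - u x) := by
    simpa only [one_mul, neg_one_mul, ← sub_eq_add_neg] using hat.lincomb hψt 1 (-1)
  refine ⟨fun x => a x - (φ x - u x), hht, ?_, ?_⟩
  -- Inside the ball the predictor vanishes on `A` and on `S`, leaving only `K`. As `K` and the
  -- complement of the open ball are closed, taking the closure of the support cannot reach `A`.
  · have hsub : tsupport (fun x => a x - (φ x - u x)) ⊆ K ∪ (Metric.ball 0 r)ᶜ := by
      refine closure_minimal (fun x hx => ?_) (hK.union Metric.isOpen_ball.isClosed_compl)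
      by_contra hc
      simp only [Set.mem_union, Set.mem_compl_iff, not_or, not_not] at hc
      refine hx ?_
      have h1 : φ x = 1 := hφ1 x (mem_ball_zero_iff.1 hc.2).le
      by_cases hxA : x ∈ A
      · have hxS : x ∉ S := fun h => h.1.2 hxA
        simp [a, u, h1, Set.indicator_of_mem hxA, Set.indicator_of_notMem hxS]
      · have hxS : x ∈ S := ⟨⟨hc.2, hxA⟩, hc.1⟩
        simp [a, u, h1, Set.indicator_of_notMem hxA, Set.indicator_of_mem hxS]
    refine hsub.trans (Set.union_subset (fun x hx => (hKE hx).2) ?_)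
    exact Set.compl_subset_compl.2 hAr
  · have hX : (fun ω => (M.I a ω - M.I (fun x => a x - (φ x - u x)) ω) ^ 2) =ᵐ[P]
        M.I (fun x => φ x - u x) ^ 2 := by
      filter_upwards [M.I_sub hat hψt] with ω hω
      rw [hω, Pi.sub_apply, sub_sub_cancel, Pi.pow_apply]
    have hvar := variance_eq_sub (M.memLp _ hψt)
    have hvle := M.variance_sub_le hφt hut
    have hul : Var[M.I u; P] ≤ δ * V :=
      (hC.variance_indicator_le hSm hSb).trans (mul_le_mul_of_nonneg_right hvol hV)
    have hm : P[M.I (fun x => φ x - u x)] = -∫ ω, M.I u ω ∂P := by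
      rw [integral_congr_ae (M.I_sub hφt hut)]
      have := integral_sub ((M.memLp φ hφt).integrable one_le_two)
        ((M.memLp u hut).integrable one_le_two)
      simp only [Pi.sub_apply]
      rw [this, hφm, zero_sub]
    have hm2 : (∫ ω, M.I u ω ∂P) ^ 2 ≤ δ := by
      rw [← sq_abs]
      nlinarith [abs_nonneg (∫ ω, M.I u ω ∂P)]
    rw [integral_congr_ae hX]
    rw [hm, neg_sq] at hvar
    linarith

end RandomSignedMeasure

theorem mainTheorem11 {d : ℕ} (hd : d = 1 ∨ d = 2)
    {Ω : Type*} [MeasurableSpace Ω] (P : Measure Ω) [IsProbabilityMeasure P]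
    (M : RandomSignedMeasure d P)
    (hstat : M.IsWideSenseStationary)
    (hiso : M.IsIsotropic)
    (hhyper : M.IsHyperuniform)
    (hnotrigid : ¬ M.IsNumberRigid)
    (C : SignedRadonMeasure d) (hC : M.IsCorrelationMeasure C) :
    ∫⁻ t, (ENNReal.ofReal ‖t‖) ^ d ∂C.variation = ∞ := by
  by_contra hmom
  have := C.isFiniteMeasure_variation hmom
  have hd0 : 0 < d := by omega
  have h0 := hhyper.integral_one_eq_zero hd0 hC
  obtain ⟨K, hK⟩ := hC.exists_variance_cutoff_le hd h0 hmom
  refine hnotrigid fun A hAb hA => ?_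
  obtain ⟨r, hr⟩ := hAb.subset_ball 0
  exact M.isLinearlyRigid_of_forall_exists (.indicator hA hAb) fun ε hε =>
    RandomSignedMeasure.exists_predictor hC hA hr (fun η hη =>
      M.exists_centred_one_on_ball hd0 hstat hK (fun f hf => hC.tendsto_covariance_cutoff h0 hf)
        r hη) hε
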